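/- Let $h_1,\dots,h_k$ be local holomorphic diffeomorphisms of $\mathbb{C}^n$ fixing the origin (biholomorphic maps between open neighbourhoods of $0$ with $h_i(0)=0$). For an open neighbourhood $V$ of $0$ on which all the $h_i$ and $h_i^{-1}$ are defined and one-to-one, the pseudogroup generated by $h_1,\dots,h_k$ on $V$ consists of all finite compositions $g=F_s\circ\cdots\circ F_1$ with $F_j\in\{h_1^{\pm1},\dots,h_k^{\pm1}\}$, where the domain ${\rm Dom}_V(g)$ is the set of all $x\in V$ such that $F_l\circ\cdots\circ F_1(x)\in V$ for every $1\le l<s$ (the empty composition is the identity of $V$). The orbit of $p\in V$ is $\mathcal{O}_V(p)=\{q\in V : q=g(p) \text{ for some element } g \text{ of the pseudogroup with } p\in{\rm Dom}_V(g)\}$. The pseudogroup is said to have finite orbits on a neighbourhood of the origin if there is an open neighbourhood $V'$ of $0$, on which all the $h_i^{\pm1}$ are defined and one-to-one, such that $\mathcal{O}_{V'}(p)$ is finite for every $p\in V'$. Let $G$ be the subgroup generated by the germs at $0$ of $h_1,\dots,h_k$ in the group ${\rm Diff}(\mathbb{C}^n,0)$ of germs at $0$ of local holomorphic diffeomorphisms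 of $\mathbb{C}^n$ fixing $0$. **Theorem A.** Fix an open neighbourhood $V$ of $0$ on which all the $h_i^{\pm1}$ are defined and one-to-one, and suppose that for every element $g$ of the pseudogroup generated by $h_1,\dots,h_k$ on $V$ and every $p\in{\rm Dom}_V(g)$ with $g(p)=p$, either $p$ is an isolated fixed point of $g$ or $g$ coincides with the identity on a neighbourhood of $p$. Then the pseudogroup has finite orbits on a neighbourhood of the origin if and only if the group $G$ is finite. -/

import Mathlib

open Filter Topology

noncomputable section

namespace LocalDynamics

/-- A local holomorphic diffeomorphism of `ℂⁿ` fixing the origin: a biholomorphic map from an open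
neighbourhood `source` of `0` onto an open neighbourhood `target` of `0`, with `0 ↦ 0`. -/
structure LocalDiffeo (n : ℕ) extends OpenPartialHomeomorph (Fin n → ℂ) (Fin n → ℂ) where
  zero_mem_source : (0 : Fin n → ℂ) ∈ toOpenPartialHomeomorph.source
  map_zero' : toOpenPartialHomeomorph 0 = 0
  holomorphic : AnalyticOnNhd ℂ toOpenPartialHomeomorph toOpenPartialHomeomorph.source
  holomorphic_symm :
    AnalyticOnNhd ℂ toOpenPartialHomeomorph.symm toOpenPartialHomeomorph.target

namespace LocalDiffeo

variable {n : ℕ}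

/-- The identity of `ℂⁿ`. -/
def refl (n : ℕ) : LocalDiffeo n where
  toOpenPartialHomeomorph := OpenPartialHomeomorph.refl (Fin n → ℂ)
  zero_mem_source := Set.mem_univ _
  map_zero' := rfl
  holomorphic := analyticOnNhd_id
  holomorphic_symm := analyticOnNhd_id

theorem zero_mem_target (f : LocalDiffeo n) :
    (0 : Fin n → ℂ) ∈ f.toOpenPartialHomeomorph.target := by
  have h := f.toOpenPartialHomeomorph.map_source f.zero_mem_source
  rwa [f.map_zero'] at h

theorem symm_zero (f : LocalDiffeo n) : f.toOpenPartialHomeomorph.symm 0 = 0 := by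
  have h := f.toOpenPartialHomeomorph.left_inv f.zero_mem_source
  rwa [f.map_zero'] at h

/-- The inverse of a local diffeomorphism. -/
def symm (f : LocalDiffeo n) : LocalDiffeo n where
  toOpenPartialHomeomorph := f.toOpenPartialHomeomorph.symm
  zero_mem_source := f.zero_mem_target
  map_zero' := f.symm_zero
  holomorphic := f.holomorphic_symm
  holomorphic_symm := f.holomorphic

/-- The composition `f ∘ g`, defined where it makes sense. -/
def comp (f g : LocalDiffeo n) : LocalDiffeo n where
  toOpenPartialHomeomorph := g.toOpenPartialHomeomorph.trans f.toOpenPartialHomeomorph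
  zero_mem_source := by
    rw [OpenPartialHomeomorph.trans_source]
    refine ⟨g.zero_mem_source, ?_⟩
    rw [Set.mem_preimage, g.map_zero']
    exact f.zero_mem_source
  map_zero' := by
    rw [OpenPartialHomeomorph.trans_apply, g.map_zero', f.map_zero']
  holomorphic := by
    intro x hx
    rw [OpenPartialHomeomorph.trans_source] at hx
    rw [OpenPartialHomeomorph.coe_trans]
    exact (f.holomorphic _ hx.2).comp (g.holomorphic _ hx.1)
  holomorphic_symm := by
    intro x hx
    rw [OpenPartialHomeomorph.trans_target] at hx
    rw [OpenPartialHomeomorph.coe_trans_symm]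
    exact (g.holomorphic_symm _ hx.2).comp (f.holomorphic_symm _ hx.1)

theorem tendsto_zero (f : LocalDiffeo n) :
    Tendsto f.toOpenPartialHomeomorph (𝓝 0) (𝓝 0) := by
  have h := f.toOpenPartialHomeomorph.continuousAt f.zero_mem_source
  rwa [ContinuousAt, f.map_zero'] at h

/-- Two local diffeomorphisms have the same germ at the origin. -/
def germSetoid (n : ℕ) : Setoid (LocalDiffeo n) where
  r f g := ⇑f.toOpenPartialHomeomorph =ᶠ[𝓝 0] ⇑g.toOpenPartialHomeomorph
  iseqv := ⟨fun _ => EventuallyEq.rfl, fun h => h.symm, fun h h' => h.trans h'⟩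

theorem comp_congr {f f' g g' : LocalDiffeo n} (hf : germSetoid n f f')
    (hg : germSetoid n g g') : germSetoid n (f.comp g) (f'.comp g') := by
  change ∀ᶠ x in 𝓝 0, f.toOpenPartialHomeomorph (g.toOpenPartialHomeomorph x) =
    f'.toOpenPartialHomeomorph (g'.toOpenPartialHomeomorph x)
  filter_upwards [g.tendsto_zero.eventually hf, hg] with x h1 h2
  rw [h1, h2]

theorem symm_congr {f g : LocalDiffeo n} (h : germSetoid n f g) :
    germSetoid n f.symm g.symm := by
  change ∀ᶠ y in 𝓝 0, f.toOpenPartialHomeomorph.symm y = g.toOpenPartialHomeomorph.symm y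
  have ht : Tendsto f.toOpenPartialHomeomorph.symm (𝓝 0) (𝓝 0) := f.symm.tendsto_zero
  filter_upwards [ht.eventually h, f.toOpenPartialHomeomorph.open_target.mem_nhds
    f.zero_mem_target, ht.eventually (g.toOpenPartialHomeomorph.open_source.mem_nhds
    g.zero_mem_source)] with y h1 h2 h3
  rw [f.toOpenPartialHomeomorph.right_inv h2] at h1
  conv_rhs => rw [h1]
  exact (g.toOpenPartialHomeomorph.left_inv h3).symm

end LocalDiffeo

/-- `Diff(ℂⁿ, 0)`: the germs at the origin of local holomorphic diffeomorphisms of `ℂⁿ` fixing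
the origin. -/
def Diff (n : ℕ) : Type := Quotient (LocalDiffeo.germSetoid n)

/-- The germ at the origin of a local diffeomorphism. -/
def LocalDiffeo.germ {n : ℕ} (f : LocalDiffeo n) : Diff n :=
  Quotient.mk (LocalDiffeo.germSetoid n) f

/-- `Diff(ℂⁿ, 0)` is a group under composition of germs. -/
instance Diff.instGroup (n : ℕ) : Group (Diff n) where
  mul := Quotient.map₂ LocalDiffeo.comp fun _ _ hf _ _ hg => LocalDiffeo.comp_congr hf hg
  one := (LocalDiffeo.refl n).germ
  inv := Quotient.map LocalDiffeo.symm fun _ _ h => LocalDiffeo.symm_congr h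
  mul_assoc := by
    rintro ⟨f⟩ ⟨g⟩ ⟨h⟩
    exact Quotient.sound (s := LocalDiffeo.germSetoid n) EventuallyEq.rfl
  one_mul := by
    rintro ⟨f⟩
    exact Quotient.sound (s := LocalDiffeo.germSetoid n) EventuallyEq.rfl
  mul_one := by
    rintro ⟨f⟩
    exact Quotient.sound (s := LocalDiffeo.germSetoid n) EventuallyEq.rfl
  inv_mul_cancel := by
    rintro ⟨f⟩
    refine Quotient.sound (s := LocalDiffeo.germSetoid n) ?_
    filter_upwards [f.toOpenPartialHomeomorph.open_source.mem_nhds f.zero_mem_source] with x hx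
    exact f.toOpenPartialHomeomorph.left_inv hx

variable {n k : ℕ}

/-- `V` is an open neighbourhood of the origin on which all the generators `h i` and their inverses
are defined (they are then one-to-one on `V`). -/
def IsAdmissible (h : Fin k → LocalDiffeo n) (V : Set (Fin n → ℂ)) : Prop :=
  IsOpen V ∧ 0 ∈ V ∧ ∀ i, V ⊆ (h i).toOpenPartialHomeomorph.source ∧
    V ⊆ (h i).toOpenPartialHomeomorph.target

/-- The letter `(i, true)` stands for `h i`, the letter `(i, false)` for its inverse. -/
def letter (h : Fin k → LocalDiffeo n) (a : Fin k × Bool) : LocalDiffeo n :=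
  if a.2 then h a.1 else (h a.1).symm

/-- The map `F_s ∘ ⋯ ∘ F_1` attached to the word `[F_1, …, F_s]` in the generators and their
inverses. It is only meaningful on the domain `wordDom h V w` below. -/
def wordMap (h : Fin k → LocalDiffeo n) : List (Fin k × Bool) → (Fin n → ℂ) → (Fin n → ℂ)
  | [], x => x
  | a :: w, x => wordMap h w ((letter h a).toOpenPartialHomeomorph x)

/-- The domain of `F_s ∘ ⋯ ∘ F_1` as an element of the pseudogroup generated by `h` on `V`: the
points `x ∈ V` such that `F_l ∘ ⋯ ∘ F_1 (x) ∈ V` for all `1 ≤ l < s`. -/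
def wordDom (h : Fin k → LocalDiffeo n) (V : Set (Fin n → ℂ)) (w : List (Fin k × Bool)) :
    Set (Fin n → ℂ) :=
  {x | x ∈ V ∧ ∀ l, 1 ≤ l → l < w.length → wordMap h (w.take l) x ∈ V}

/-- The orbit of `p` under the pseudogroup generated by `h` on `V`: the points `q ∈ V` of the form
`q = F(p)`, with `F` in the pseudogroup and `p` in the domain of `F`. -/
def orbit (h : Fin k → LocalDiffeo n) (V : Set (Fin n → ℂ)) (p : Fin n → ℂ) :
    Set (Fin n → ℂ) :=
  {q | q ∈ V ∧ ∃ w, p ∈ wordDom h V w ∧ q = wordMap h w p}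

/-- The pseudogroup generated by `h` has finite orbits (on some neighbourhood of the origin). -/
def HasFiniteOrbits (h : Fin k → LocalDiffeo n) : Prop :=
  ∃ V, IsAdmissible h V ∧ ∀ p ∈ V, (orbit h V p).Finite

/-- `p` is an isolated fixed point of `g` (for `p` with `g p = p`): no other point near `p`
is fixed by `g`. -/
def IsIsolatedFixedPoint (g : (Fin n → ℂ) → (Fin n → ℂ)) (p : Fin n → ℂ) : Prop :=
  g p = p ∧ ∀ᶠ x in 𝓝[≠] p, g x ≠ x

/-- Every fixed point of every element of the pseudogroup generated by `h` on `V` is isolated, unless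
that element is the identity near that point. -/
def FixedPointsIsolatedOrTrivial (h : Fin k → LocalDiffeo n) (V : Set (Fin n → ℂ)) : Prop :=
  ∀ w, ∀ p ∈ wordDom h V w, wordMap h w p = p →
    IsIsolatedFixedPoint (wordMap h w) p ∨ ∀ᶠ x in 𝓝 p, wordMap h w x = x

/-- The subgroup of `Diff(ℂⁿ, 0)` generated by the germs of the `h i`. -/
def germGroup (h : Fin k → LocalDiffeo n) : Subgroup (Diff n) :=
  Subgroup.closure (Set.range fun i => (h i).germ)

end LocalDynamics

end

noncomputable section

namespace LocalDynamics

variable {n k : ℕ} {h : Fin k → LocalDiffeo n} {S V : Set (Fin n → ℂ)}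

/-! ### Words in the generators -/

/-! If the group is finite, finitely many words represent all germs at 0. Near 0, appending a letter
to a representative gives the same map as another representative, so an orbit has at most as many
points as there are representatives.

Conversely, suppose the group is infinite and orbits are finite. The key is
`exists_infinite_germsAt`: each small sphere contains a point `x` with infinitely many germs of
words staying in the closed ball. Otherwise compactness bounds these counts by some N on the sphere.
The points with at most N germs in the closed ball, and those with more than N in the open ball, are
disjoint open sets by semicontinuity; they cover the closed ball because counts are constant along
orbits, and they separate the sphere from 0, contradicting connectedness. Finiteness of the orbit of
`x` forces two words with distinct germs to agree at `x`, so `x` is an isolated fixed point of some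
word. There are countably many words, each with countably many isolated fixed points, but
uncountably many radii. -/

theorem letter_zero (a : Fin k × Bool) : (letter h a).toOpenPartialHomeomorph 0 = 0 :=
  (letter h a).map_zero'

theorem IsAdmissible.subset_letter_source (hV : IsAdmissible h V) (a : Fin k × Bool) :
    V ⊆ (letter h a).toOpenPartialHomeomorph.source := by
  obtain ⟨i, b⟩ := a
  cases b
  · exact (hV.2.2 i).2
  · exact (hV.2.2 i).1

theorem IsAdmissible.analyticAt_letter (hV : IsAdmissible h V) (a : Fin k × Bool)
    {x : Fin n → ℂ} (hx : x ∈ V) : AnalyticAt ℂ (letter h a).toOpenPartialHomeomorph x :=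
  (letter h a).holomorphic x (hV.subset_letter_source a hx)

/-- The formal inverse of a letter. -/
def flipLetter (a : Fin k × Bool) : Fin k × Bool := (a.1, !a.2)

theorem letter_flip (a : Fin k × Bool) : letter h (flipLetter a) = (letter h a).symm := by
  obtain ⟨i, b⟩ := a
  cases b <;> rfl

theorem IsAdmissible.letter_flip_letter (hV : IsAdmissible h V) (a : Fin k × Bool)
    {x : Fin n → ℂ} (hx : x ∈ V) : (letter h (flipLetter a)).toOpenPartialHomeomorph
      ((letter h a).toOpenPartialHomeomorph x) = x := by
  rw [letter_flip]
  exact (letter h a).toOpenPartialHomeomorph.left_inv (hV.subset_letter_source a hx)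

theorem wordMap_append (u v : List (Fin k × Bool)) (x : Fin n → ℂ) :
    wordMap h (u ++ v) x = wordMap h v (wordMap h u x) := by
  induction u generalizing x with
  | nil => rfl
  | cons a u ih => exact ih _

/-- The formal inverse of a word. -/
def invWord : List (Fin k × Bool) → List (Fin k × Bool)
  | [] => []
  | a :: w => invWord w ++ [flipLetter a]

/-- The point `x` and all its images under the initial segments of `w`, including `w` itself,
lie in `S`. -/
def Stays (h : Fin k → LocalDiffeo n) (S : Set (Fin n → ℂ)) :
    List (Fin k × Bool) → (Fin n → ℂ) → Prop
  | [], x => x ∈ S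
  | a :: w, x => x ∈ S ∧ Stays h S w ((letter h a).toOpenPartialHomeomorph x)

namespace Stays

variable {w u v : List (Fin k × Bool)} {x : Fin n → ℂ}

theorem mem (hw : Stays h S w x) : x ∈ S := by
  cases w with
  | nil => exact hw
  | cons a w => exact hw.1

theorem mono {T : Set (Fin n → ℂ)} (hST : S ⊆ T) (hw : Stays h S w x) : Stays h T w x := by
  induction w generalizing x with
  | nil => exact hST hw
  | cons a w ih => exact ⟨hST hw.1, ih hw.2⟩

theorem append_iff : Stays h S (u ++ v) x ↔ Stays h S u x ∧ Stays h S v (wordMap h u x) := by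
  induction u generalizing x with
  | nil => exact ⟨fun hv => ⟨hv.mem, hv⟩, fun hv => hv.2⟩
  | cons a u ih =>
    change x ∈ S ∧ Stays h S (u ++ v) _ ↔ (x ∈ S ∧ Stays h S u _) ∧ Stays h S v _
    rw [ih, and_assoc]
    rfl

theorem map_mem (hw : Stays h S w x) : wordMap h w x ∈ S := by
  rw [← List.append_nil w, append_iff] at hw
  exact hw.2

theorem take_mem (hw : Stays h S w x) (l : ℕ) : wordMap h (w.take l) x ∈ S := by
  rw [← List.take_append_drop l w, append_iff] at hw
  exact hw.1.map_mem

/-- `Stays` also constrains the endpoint, which `wordDom` does not; this makes concatenation and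
inversion of words clean. -/
theorem mem_wordDom (hw : Stays h S w x) (hSV : S ⊆ V) : x ∈ wordDom h V w :=
  ⟨hSV hw.mem, fun l _ _ => hSV (hw.take_mem l)⟩

theorem zero (hS : 0 ∈ S) (w : List (Fin k × Bool)) : Stays h S w 0 := by
  induction w with
  | nil => exact hS
  | cons a w ih =>
    refine ⟨hS, ?_⟩
    rwa [letter_zero]

theorem analyticAt (hV : IsAdmissible h V) (hw : Stays h V w x) :
    AnalyticAt ℂ (wordMap h w) x := by
  induction w generalizing x with
  | nil => exact analyticAt_id
  | cons a w ih => exact (ih hw.2).comp (hV.analyticAt_letter a hw.1)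

theorem eventually (hV : IsAdmissible h V) (hSV : S ⊆ V) (hS : IsOpen S) (hw : Stays h S w x) :
    ∀ᶠ y in 𝓝 x, Stays h S w y := by
  induction w generalizing x with
  | nil => exact hS.mem_nhds hw
  | cons a w ih =>
    filter_upwards [hS.mem_nhds hw.1,
      (hV.analyticAt_letter a (hSV hw.1)).continuousAt.eventually (ih hw.2)] with y h1 h2
    exact ⟨h1, h2⟩

/-- The inverse word retraces the same points backwards, so it never leaves `S`. -/
theorem invWord (hV : IsAdmissible h V) (hSV : S ⊆ V) (hw : Stays h S w x) :
    Stays h S (invWord w) (wordMap h w x) ∧ wordMap h (invWord w) (wordMap h w x) = x := by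
  induction w generalizing x with
  | nil => exact ⟨hw, rfl⟩
  | cons a w ih =>
    obtain ⟨h1, h2⟩ := ih hw.2
    have h3 := hV.letter_flip_letter a (hSV hw.1)
    change Stays h S (LocalDynamics.invWord w ++ [flipLetter a]) (wordMap h w _) ∧
      wordMap h (LocalDynamics.invWord w ++ [flipLetter a]) (wordMap h w _) = x
    rw [append_iff, wordMap_append, h2]
    refine ⟨⟨h1, hw.2.mem, ?_⟩, h3⟩
    change (letter h (flipLetter a)).toOpenPartialHomeomorph _ ∈ S
    rw [h3]
    exact hw.1

/-- Near `wordMap h w x`, the formal inverse of `w` is a right inverse of `w`. -/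
theorem eventually_wordMap_invWord (hV : IsAdmissible h V) (hw : Stays h V w x) :
    ∀ᶠ y in 𝓝 (wordMap h w x), wordMap h w (wordMap h (LocalDynamics.invWord w) y) = y := by
  induction w generalizing x with
  | nil => exact Eventually.of_forall fun _ => rfl
  | cons a w ih =>
    obtain ⟨h1, h2⟩ := hw.2.invWord hV subset_rfl
    have hc := (h1.analyticAt hV).continuousAt
    rw [ContinuousAt, h2] at hc
    have hsrc := hV.subset_letter_source a hw.1
    have ht := (letter h a).toOpenPartialHomeomorph.open_target.mem_nhds
      ((letter h a).toOpenPartialHomeomorph.map_source hsrc)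
    filter_upwards [ih hw.2, hc.eventually ht] with y h3 h4
    change wordMap h w ((letter h a).toOpenPartialHomeomorph
      (wordMap h (LocalDynamics.invWord w ++ [flipLetter a]) y)) = y
    rw [wordMap_append]
    change wordMap h w ((letter h a).toOpenPartialHomeomorph
      ((letter h (flipLetter a)).toOpenPartialHomeomorph
        (wordMap h (LocalDynamics.invWord w) y))) = y
    rw [letter_flip]
    change wordMap h w ((letter h a).toOpenPartialHomeomorph
      ((letter h a).toOpenPartialHomeomorph.symm (wordMap h (LocalDynamics.invWord w) y))) = y
    rw [(letter h a).toOpenPartialHomeomorph.right_inv h4, h3]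

end Stays

/-! ### The germ group and germs of words -/

/-- The germ of functions underlying an element of `Diff(ℂⁿ, 0)`. -/
def Diff.toGerm (g : Diff n) : Germ (𝓝 (0 : Fin n → ℂ)) (Fin n → ℂ) :=
  Quotient.lift (s := LocalDiffeo.germSetoid n)
    (fun f => ((⇑f.toOpenPartialHomeomorph : (Fin n → ℂ) → (Fin n → ℂ)) :
      Germ (𝓝 (0 : Fin n → ℂ)) (Fin n → ℂ)))
    (fun _ _ hfg => Germ.coe_eq.2 hfg) g

theorem Diff.toGerm_injective : Function.Injective (Diff.toGerm (n := n)) := by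
  rintro ⟨f⟩ ⟨g⟩ hfg
  exact Quotient.sound (s := LocalDiffeo.germSetoid n) (Germ.coe_eq.1 hfg)

/-- The composition of the letters of a word, as a local diffeomorphism. -/
def wordDiffeo (h : Fin k → LocalDiffeo n) : List (Fin k × Bool) → LocalDiffeo n
  | [] => LocalDiffeo.refl n
  | a :: w => (wordDiffeo h w).comp (letter h a)

theorem coe_wordDiffeo (w : List (Fin k × Bool)) :
    ⇑(wordDiffeo h w).toOpenPartialHomeomorph = wordMap h w := by
  induction w with
  | nil => rfl
  | cons a w ih =>
    funext x
    change (wordDiffeo h w).toOpenPartialHomeomorph ((letter h a).toOpenPartialHomeomorph x) =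
      wordMap h w ((letter h a).toOpenPartialHomeomorph x)
    rw [ih]

theorem germ_letter_mem (a : Fin k × Bool) : (letter h a).germ ∈ germGroup h := by
  obtain ⟨i, b⟩ := a
  have hi : (h i).germ ∈ germGroup h := Subgroup.subset_closure ⟨i, rfl⟩
  cases b
  · exact (germGroup h).inv_mem hi
  · exact hi

theorem germ_wordDiffeo_mem (w : List (Fin k × Bool)) :
    (wordDiffeo h w).germ ∈ germGroup h := by
  induction w with
  | nil => exact (germGroup h).one_mem
  | cons a w ih => exact (germGroup h).mul_mem ih (germ_letter_mem a)

/-- The order is reversed because the first letter of a word acts first. -/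
theorem germ_wordDiffeo_append (u v : List (Fin k × Bool)) :
    (wordDiffeo h (u ++ v)).germ = (wordDiffeo h v).germ * (wordDiffeo h u).germ := by
  induction u with
  | nil => exact (mul_one _).symm
  | cons a u ih =>
    change (wordDiffeo h (u ++ v)).germ * (letter h a).germ =
      (wordDiffeo h v).germ * ((wordDiffeo h u).germ * (letter h a).germ)
    rw [ih, mul_assoc]

theorem germ_letter_flip (a : Fin k × Bool) :
    (letter h (flipLetter a)).germ = (letter h a).germ⁻¹ := by
  rw [letter_flip]
  rfl

theorem germ_wordDiffeo_invWord (w : List (Fin k × Bool)) :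
    (wordDiffeo h (invWord w)).germ = (wordDiffeo h w).germ⁻¹ := by
  induction w with
  | nil => exact inv_one.symm
  | cons a w ih =>
    change (wordDiffeo h (invWord w ++ [flipLetter a])).germ =
      ((wordDiffeo h w).germ * (letter h a).germ)⁻¹
    rw [germ_wordDiffeo_append, ih, mul_inv_rev, ← germ_letter_flip]
    exact congrArg (· * (wordDiffeo h w).germ⁻¹) (one_mul (letter h (flipLetter a)).germ)

/-- Germs of words are closed under products (concatenation) and inverses (formal inversion), so
they already form the generated subgroup. -/
theorem coe_germGroup :
    (germGroup h : Set (Diff n)) = Set.range fun w => (wordDiffeo h w).germ := by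
  refine Set.Subset.antisymm (fun g hg => ?_) ?_
  · refine Subgroup.closure_induction (p := fun g _ => g ∈ Set.range
      fun w => (wordDiffeo h w).germ) ?_ ?_ ?_ ?_ hg
    · rintro _ ⟨i, rfl⟩
      exact ⟨[(i, true)], one_mul (h i).germ⟩
    · exact ⟨[], rfl⟩
    · rintro _ _ _ _ ⟨u, rfl⟩ ⟨v, rfl⟩
      exact ⟨v ++ u, germ_wordDiffeo_append v u⟩
    · rintro _ _ ⟨u, rfl⟩
      exact ⟨invWord u, germ_wordDiffeo_invWord u⟩
  · rintro _ ⟨w, rfl⟩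
    exact germ_wordDiffeo_mem w

/-- The germ at `x` of the map attached to a word. -/
def wordGerm (h : Fin k → LocalDiffeo n) (x : Fin n → ℂ) (w : List (Fin k × Bool)) :
    Germ (𝓝 x) (Fin n → ℂ) :=
  (wordMap h w : Germ (𝓝 x) (Fin n → ℂ))

theorem wordGerm_eq_iff {x : Fin n → ℂ} {u v : List (Fin k × Bool)} :
    wordGerm h x u = wordGerm h x v ↔ ∀ᶠ y in 𝓝 x, wordMap h u y = wordMap h v y :=
  Germ.coe_eq

theorem finite_germGroup_iff :
    Finite (germGroup h) ↔ (Set.range (wordGerm h 0)).Finite := by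
  have himg : Diff.toGerm '' (germGroup h : Set (Diff n)) = Set.range (wordGerm h 0) := by
    rw [coe_germGroup, ← Set.range_comp]
    congr 1
    funext w
    change ((⇑(wordDiffeo h w).toOpenPartialHomeomorph : (Fin n → ℂ) → (Fin n → ℂ)) :
      Germ (𝓝 (0 : Fin n → ℂ)) (Fin n → ℂ)) = _
    rw [coe_wordDiffeo]
    rfl
  rw [← himg, Set.finite_image_iff Diff.toGerm_injective.injOn]
  exact Iff.rfl

/-! ### A finite germ group has finite orbits -/

theorem hasFiniteOrbits_of_finite (hV : IsAdmissible h V) (hfin : Finite (germGroup h)) :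
    HasFiniteOrbits h := by
  rw [finite_germGroup_iff, ← Set.image_univ] at hfin
  obtain ⟨T, -, hT⟩ := Set.exists_subset_bijOn Set.univ (wordGerm h 0)
  have hTfin : T.Finite := Set.Finite.of_finite_image (hT.image_eq ▸ hfin) hT.injOn
  have hrep : ∀ u, ∃ w ∈ T, ∀ᶠ y in 𝓝 0, wordMap h u y = wordMap h w y := fun u => by
    obtain ⟨w, hw, hwu⟩ := hT.surjOn (Set.mem_image_of_mem (wordGerm h 0) (Set.mem_univ u))
    exact ⟨w, hw, wordGerm_eq_iff.1 hwu.symm⟩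
  -- Only finitely many germ identities are needed, one per representative and letter, so one
  -- neighbourhood serves words of every length.
  have hev : ∀ᶠ y in 𝓝 0, (∃ w ∈ T, wordMap h [] y = wordMap h w y) ∧
      ∀ w ∈ T, ∀ a, ∃ w' ∈ T, wordMap h (w ++ [a]) y = wordMap h w' y := by
    refine Filter.Eventually.and ?_ ?_
    · obtain ⟨w, hw, hwy⟩ := hrep []
      exact hwy.mono fun y hy => ⟨w, hw, hy⟩
    · rw [eventually_all_finite hTfin]
      intro w _
      rw [eventually_all]
      intro a
      obtain ⟨w', hw', hwy⟩ := hrep (w ++ [a])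
      exact hwy.mono fun y hy => ⟨w', hw', hy⟩
  obtain ⟨U, hU, hUo, h0U⟩ := eventually_nhds_iff.1 hev
  refine ⟨U ∩ V, ⟨hUo.inter hV.1, ⟨h0U, hV.2.1⟩, fun i =>
    ⟨Set.inter_subset_right.trans (hV.2.2 i).1, Set.inter_subset_right.trans (hV.2.2 i).2⟩⟩,
    fun p hp => (hTfin.image fun w => wordMap h w p).subset ?_⟩
  rintro _ ⟨-, u, -, rfl⟩
  suffices ∃ w ∈ T, wordMap h u p = wordMap h w p by
    obtain ⟨w, hw, hwu⟩ := this
    exact ⟨w, hw, hwu.symm⟩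
  induction u using List.reverseRecOn with
  | nil => exact (hU p hp.1).1
  | append_singleton u a ih =>
    obtain ⟨w, hw, hwu⟩ := ih
    obtain ⟨w', hw', hww'⟩ := (hU p hp.1).2 w hw a
    refine ⟨w', hw', ?_⟩
    rw [← hww', wordMap_append, wordMap_append, hwu]

/-! ### Counting the germs of the words that stay in a given set -/

/-- The germs at `x` of the words along which `x` stays in `S`. -/
def germsAt (h : Fin k → LocalDiffeo n) (S : Set (Fin n → ℂ)) (x : Fin n → ℂ) :
    Set (Germ (𝓝 x) (Fin n → ℂ)) :=
  wordGerm h x '' {w | Stays h S w x}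

/-- One word per germ: counting germs becomes counting words, which can be compared at different
base points. -/
theorem exists_transversal (h : Fin k → LocalDiffeo n) (S : Set (Fin n → ℂ)) (x : Fin n → ℂ) :
    ∃ T : Set (List (Fin k × Bool)), (∀ w ∈ T, Stays h S w x) ∧
      Set.InjOn (wordGerm h x) T ∧ T.encard = (germsAt h S x).encard ∧
      ∀ u, Stays h S u x → ∃ w ∈ T, ∀ᶠ y in 𝓝 x, wordMap h u y = wordMap h w y := by
  obtain ⟨T, hTS, hT⟩ := Set.exists_subset_bijOn {w | Stays h S w x} (wordGerm h x)
  refine ⟨T, hTS, hT.injOn, ?_, fun u hu => ?_⟩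
  · rw [← hT.injOn.encard_image, hT.image_eq]
    rfl
  · obtain ⟨w, hw, hwu⟩ := hT.surjOn (Set.mem_image_of_mem (wordGerm h x) hu)
    exact ⟨w, hw, wordGerm_eq_iff.1 hwu.symm⟩

theorem germsAt_mono {T : Set (Fin n → ℂ)} (hST : S ⊆ T) (x : Fin n → ℂ) :
    germsAt h S x ⊆ germsAt h T x :=
  Set.image_mono fun _ hw => hw.mono hST

theorem germsAt_zero (hS : 0 ∈ S) : germsAt h S 0 = Set.range (wordGerm h 0) := by
  rw [← Set.image_univ]
  exact congrArg (wordGerm h 0 '' ·) (Set.eq_univ_of_forall fun w => Stays.zero hS w)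

/-- The number of germs of words staying in a closed set is upper semicontinuous. -/
theorem eventually_encard_germsAt_le (hV : IsAdmissible h V) (hSV : S ⊆ V) (hS : IsClosed S)
    {x : Fin n → ℂ} (hfin : (germsAt h S x).Finite) :
    ∀ᶠ y in 𝓝 x, (germsAt h S y).encard ≤ (germsAt h S x).encard := by
  by_cases hx : x ∈ S
  swap
  · filter_upwards [hS.isOpen_compl.mem_nhds hx] with y hy
    have : germsAt h S y = ∅ :=
      Set.image_eq_empty.2 (Set.eq_empty_of_forall_notMem fun w hw => hy hw.mem)
    rw [this, Set.encard_empty]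
    exact bot_le
  obtain ⟨T, hTS, -, hTc, hrep⟩ := exists_transversal h S x
  have hTfin : T.Finite := by
    rw [← Set.encard_lt_top_iff, hTc]
    exact hfin.encard_lt_top
  -- The representatives at `x` still suffice at `y`: if `w ++ [a]` leaves `S` at `x`, it also does
  -- so at `y`, since `S` is closed; otherwise its representative persists.
  have hstep : ∀ᶠ y in 𝓝 x, (∃ w ∈ T, wordMap h [] =ᶠ[𝓝 y] wordMap h w) ∧
      ∀ w ∈ T, ContinuousAt (wordMap h w) y ∧ ∀ a, wordMap h (w ++ [a]) y ∈ S →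
        ∃ w' ∈ T, wordMap h (w ++ [a]) =ᶠ[𝓝 y] wordMap h w' := by
    refine Filter.Eventually.and ?_ ?_
    · obtain ⟨w, hw, hwy⟩ := hrep [] hx
      exact hwy.eventually_nhds.mono fun y hy => ⟨w, hw, hy⟩
    · rw [eventually_all_finite hTfin]
      intro w hw
      have hwV := (hTS w hw).mono hSV
      refine Filter.Eventually.and
        ((hwV.analyticAt hV).eventually_analyticAt.mono fun y hy => hy.continuousAt) ?_
      rw [eventually_all]
      intro a
      by_cases ha : wordMap h (w ++ [a]) x ∈ S
      · have hst : Stays h S (w ++ [a]) x := by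
          rw [Stays.append_iff]
          rw [wordMap_append] at ha
          exact ⟨hTS w hw, (hTS w hw).map_mem, ha⟩
        obtain ⟨w', hw', hwy⟩ := hrep _ hst
        exact hwy.eventually_nhds.mono fun y hy _ => ⟨w', hw', hy⟩
      · have hc : ContinuousAt (wordMap h (w ++ [a])) x := by
          have h1 := (hV.analyticAt_letter a hwV.map_mem).continuousAt.comp
            (hwV.analyticAt hV).continuousAt
          refine h1.congr (Eventually.of_forall fun y => ?_)
          rw [wordMap_append]
          rfl
        exact (hc.eventually (hS.isOpen_compl.mem_nhds ha)).mono fun y hy hy' => absurd hy' hy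
  filter_upwards [hstep] with y hy
  rw [← hTc]
  refine le_trans (Set.encard_le_encard ?_) (Set.encard_image_le (wordGerm h y) T)
  rintro _ ⟨u, hu, rfl⟩
  suffices ∃ w ∈ T, wordMap h u =ᶠ[𝓝 y] wordMap h w by
    obtain ⟨w, hw, hwu⟩ := this
    exact ⟨w, hw, wordGerm_eq_iff.2 hwu.symm⟩
  change Stays h S u y at hu
  induction u using List.reverseRecOn with
  | nil => exact hy.1
  | append_singleton u a ih =>
    obtain ⟨w, hw, hwu⟩ := ih (Stays.append_iff.1 hu).1
    have hcongr : wordMap h (u ++ [a]) =ᶠ[𝓝 y] wordMap h (w ++ [a]) := by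
      filter_upwards [hwu] with z hz
      rw [wordMap_append, wordMap_append, hz]
    have hmem := hu.map_mem
    rw [hcongr.eq_of_nhds] at hmem
    obtain ⟨w', hw', hww'⟩ := (hy.2 w hw).2 a hmem
    exact ⟨w', hw', hcongr.trans hww'⟩

/-- Distinct germs of analytic functions remain distinct at nearby points. -/
theorem eventually_not_eventuallyEq {f g : (Fin n → ℂ) → (Fin n → ℂ)} {x : Fin n → ℂ}
    (hf : AnalyticAt ℂ f x) (hg : AnalyticAt ℂ g x) (hfg : ¬ f =ᶠ[𝓝 x] g) :
    ∀ᶠ y in 𝓝 x, ¬ f =ᶠ[𝓝 y] g := by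
  obtain ⟨r, hr, hball⟩ := Metric.eventually_nhds_iff_ball.1
    (hf.eventually_analyticAt.and hg.eventually_analyticAt)
  filter_upwards [Metric.ball_mem_nhds x hr] with y hy heq
  have hpre : IsPreconnected (Metric.ball x r) := (convex_ball x r).isPreconnected
  -- Identity theorem: germs agreeing at `y` agree on the whole ball, hence at `x`.
  have hEq := AnalyticOnNhd.eqOn_of_preconnected_of_eventuallyEq (fun z hz => (hball z hz).1)
    (fun z hz => (hball z hz).2) hpre hy heq
  exact hfg (hEq.eventuallyEq_of_mem (Metric.ball_mem_nhds x hr))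

/-- The number of germs of words staying in an open set is lower semicontinuous. -/
theorem eventually_le_encard_germsAt (hV : IsAdmissible h V) (hSV : S ⊆ V) (hS : IsOpen S)
    {x : Fin n → ℂ} {N : ℕ} (hN : (N : ℕ∞) ≤ (germsAt h S x).encard) :
    ∀ᶠ y in 𝓝 x, (N : ℕ∞) ≤ (germsAt h S y).encard := by
  obtain ⟨T₀, hTS, hinj, hTc, -⟩ := exists_transversal h S x
  rw [← hTc] at hN
  -- `T₀` may be infinite; only finitely many open conditions can be intersected.
  obtain ⟨T, hTT, hTN⟩ := Set.exists_subset_encard_eq hN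
  have hTfin : T.Finite := Set.finite_of_encard_eq_coe hTN
  have han : ∀ w ∈ T, AnalyticAt ℂ (wordMap h w) x :=
    fun w hw => ((hTS w (hTT hw)).mono hSV).analyticAt hV
  have hstay : ∀ᶠ y in 𝓝 x, ∀ w ∈ T, Stays h S w y := by
    rw [eventually_all_finite hTfin]
    exact fun w hw => (hTS w (hTT hw)).eventually hV hSV hS
  have hne : ∀ᶠ y in 𝓝 x, ∀ u ∈ T, ∀ v ∈ T, u ≠ v → ¬ wordMap h u =ᶠ[𝓝 y] wordMap h v := by
    rw [eventually_all_finite hTfin]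
    intro u hu
    rw [eventually_all_finite hTfin]
    intro v hv
    by_cases huv : u = v
    · exact Eventually.of_forall fun _ huv' => absurd huv huv'
    · refine (eventually_not_eventuallyEq (han u hu) (han v hv) fun heq => huv ?_).mono
        fun y hy _ => hy
      exact hinj (hTT hu) (hTT hv) (wordGerm_eq_iff.2 heq)
  filter_upwards [hstay, hne] with y h1 h2
  have hinjy : Set.InjOn (wordGerm h y) T := fun u hu v hv huv => by
    by_contra hne'
    exact h2 u hu v hv hne' (wordGerm_eq_iff.1 huv)
  rw [← hTN, ← hinjy.encard_image]
  exact Set.encard_le_encard (Set.image_mono h1)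

/-- The number of germs does not increase along an orbit. -/
theorem encard_germsAt_wordMap_le (hV : IsAdmissible h V) (hSV : S ⊆ V)
    {w : List (Fin k × Bool)} {x : Fin n → ℂ} (hw : Stays h S w x) :
    (germsAt h S (wordMap h w x)).encard ≤ (germsAt h S x).encard := by
  obtain ⟨T, hTS, hinj, hTc, -⟩ := exists_transversal h S (wordMap h w x)
  -- Prefixing by `w` is injective on germs because `w` has a local right inverse.
  have hinjx : Set.InjOn (wordGerm h x ∘ (w ++ ·)) T := fun u hu v hv huv => by
    refine hinj hu hv (wordGerm_eq_iff.2 ?_)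
    have huv' := wordGerm_eq_iff.1 huv
    obtain ⟨h1, h2⟩ := (hw.mono hSV).invWord hV subset_rfl
    have hc := (h1.analyticAt hV).continuousAt
    rw [ContinuousAt, h2] at hc
    filter_upwards [(hw.mono hSV).eventually_wordMap_invWord hV, hc.eventually huv'] with y h3 h4
    rwa [wordMap_append, wordMap_append, h3] at h4
  rw [← hTc, ← hinjx.encard_image]
  refine Set.encard_le_encard ?_
  rintro _ ⟨u, hu, rfl⟩
  exact ⟨w ++ u, Stays.append_iff.2 ⟨hw, hTS u hu⟩, rfl⟩

/-- If `w` takes `x` to a point where the number of germs is at most `N`, then the number of germs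
at `x` is at most `N`. -/
theorem encard_germsAt_le_wordMap (hV : IsAdmissible h V) (hSV : S ⊆ V)
    {w : List (Fin k × Bool)} {x : Fin n → ℂ} (hw : Stays h S w x) :
    (germsAt h S x).encard ≤ (germsAt h S (wordMap h w x)).encard := by
  obtain ⟨h1, h2⟩ := hw.invWord hV hSV
  have := encard_germsAt_wordMap_le hV hSV h1
  rwa [h2] at this

/-! ### Points with infinitely many germs -/

/-- A trajectory that never meets the sphere cannot tell the closed ball from the open one, so both
counts agree at such a point. -/
theorem stays_ball_of_forall {r : ℝ} {x : Fin n → ℂ} {w : List (Fin k × Bool)}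
    (hw : Stays h (Metric.closedBall 0 r) w x)
    (hsphere : ∀ u, Stays h (Metric.closedBall 0 r) u x →
      wordMap h u x ∉ Metric.sphere (0 : Fin n → ℂ) r) :
    Stays h (Metric.ball 0 r) w x := by
  have hball : ∀ u, Stays h (Metric.closedBall 0 r) u x → wordMap h u x ∈ Metric.ball 0 r :=
    fun u hu => by
      have h1 := Metric.mem_closedBall.1 hu.map_mem
      exact Metric.mem_ball.2 (lt_of_le_of_ne h1 (hsphere u hu))
  induction w using List.reverseRecOn with
  | nil => exact hball [] hw
  | append_singleton u a ih =>
    have hu := ih (Stays.append_iff.1 hw).1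
    have h1 := hball _ hw
    rw [wordMap_append] at h1
    exact Stays.append_iff.2 ⟨hu, hu.map_mem, h1⟩

/-- If the germ group is infinite, every small sphere contains a point admitting infinitely many
germs of words along which it stays in the closed ball. -/
theorem exists_infinite_germsAt (hV : IsAdmissible h V) {r : ℝ} (hr : 0 < r)
    (hrV : Metric.closedBall 0 r ⊆ V) (hinf : ¬ Finite (germGroup h)) :
    ∃ x ∈ Metric.sphere (0 : Fin n → ℂ) r, (germsAt h (Metric.closedBall 0 r) x).Infinite := by
  rw [finite_germGroup_iff] at hinf
  by_contra! hcon
  -- In dimension 0 the sphere is empty, but all germs coincide.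
  have hn : Nontrivial (Fin n → ℂ) := by
    by_contra hn
    rw [not_nontrivial_iff_subsingleton] at hn
    refine hinf (Set.Subsingleton.finite ?_)
    rintro _ ⟨u, rfl⟩ _ ⟨v, rfl⟩
    exact wordGerm_eq_iff.2 (Eventually.of_forall fun y => Subsingleton.elim _ _)
  obtain ⟨N, hN⟩ : ∃ N : ℕ, ∀ x ∈ Metric.sphere (0 : Fin n → ℂ) r,
      (germsAt h (Metric.closedBall 0 r) x).encard ≤ N := by
    refine (isCompact_sphere (0 : Fin n → ℂ) r).induction_on
      (p := fun s => ∃ N : ℕ, ∀ x ∈ s, (germsAt h (Metric.closedBall 0 r) x).encard ≤ N)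
      ⟨0, by simp⟩ (fun s t hst ⟨N, hN⟩ => ⟨N, fun x hx => hN x (hst hx)⟩) ?_ ?_
    · rintro s t ⟨N, hN⟩ ⟨M, hM⟩
      refine ⟨max N M, ?_⟩
      rintro x (hx | hx)
      · exact (hN x hx).trans (by exact_mod_cast le_max_left N M)
      · exact (hM x hx).trans (by exact_mod_cast le_max_right N M)
    · intro x hx
      refine ⟨_, mem_nhdsWithin_of_mem_nhds (eventually_encard_germsAt_le hV hrV
        Metric.isClosed_closedBall (hcon x hx)), (germsAt h (Metric.closedBall 0 r) x).ncard, ?_⟩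
      intro y hy
      rw [(hcon x hx).cast_ncard_eq]
      exact hy
  let A := {x | (germsAt h (Metric.closedBall 0 r) x).encard ≤ N}
  let B := {x | ((N + 1 : ℕ) : ℕ∞) ≤ (germsAt h (Metric.ball 0 r) x).encard}
  have hAnhds : ∀ x ∈ A, x ∈ interior A := fun x hx => mem_interior_iff_mem_nhds.2 <|
    (eventually_encard_germsAt_le hV hrV Metric.isClosed_closedBall
      (Set.finite_of_encard_le_coe hx)).mono fun y hy => hy.trans hx
  have hBnhds : ∀ x ∈ B, x ∈ interior B := fun x hx => mem_interior_iff_mem_nhds.2 <|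
    eventually_le_encard_germsAt hV (Metric.ball_subset_closedBall.trans hrV) Metric.isOpen_ball hx
  have hpre : IsPreconnected (Metric.closedBall (0 : Fin n → ℂ) r) :=
    (convex_closedBall 0 r).isPreconnected
  obtain ⟨x₀, hx₀⟩ := NormedSpace.sphere_nonempty (x := (0 : Fin n → ℂ)).2 hr.le
  have hcover : Metric.closedBall (0 : Fin n → ℂ) r ⊆ interior A ∪ interior B := fun x hx => by
    by_cases hxA : x ∈ A
    · exact Or.inl (hAnhds x hxA)
    · refine Or.inr (hBnhds x ?_)
      -- Reaching the sphere would bound the count at `x` by N, since counts are constant along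
      -- orbits.
      have hst : ∀ u, Stays h (Metric.closedBall 0 r) u x →
          wordMap h u x ∉ Metric.sphere (0 : Fin n → ℂ) r := fun u hu hus =>
        hxA ((encard_germsAt_le_wordMap hV hrV hu).trans (hN _ hus))
      have hsub : germsAt h (Metric.closedBall 0 r) x ⊆ germsAt h (Metric.ball 0 r) x :=
        Set.image_mono fun w hw => stays_ball_of_forall hw hst
      have hlt : (N : ℕ∞) < (germsAt h (Metric.closedBall 0 r) x).encard := not_le.1 hxA
      have h2 := (Order.add_one_le_of_lt hlt).trans (Set.encard_le_encard hsub)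
      change ((N + 1 : ℕ) : ℕ∞) ≤ _
      exact_mod_cast h2
  have h0B : (0 : Fin n → ℂ) ∈ B := by
    change ((N + 1 : ℕ) : ℕ∞) ≤ _
    -- Every word fixes 0, so all germs of the infinite group count there.
    rw [germsAt_zero (Metric.mem_ball_self hr), Set.Infinite.encard_eq hinf]
    exact le_top
  obtain ⟨z, -, hzA, hzB⟩ := hpre _ _ isOpen_interior isOpen_interior hcover
    ⟨x₀, Metric.sphere_subset_closedBall hx₀, hAnhds x₀ (hN x₀ hx₀)⟩
    ⟨0, Metric.mem_closedBall_self hr.le, hBnhds 0 h0B⟩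
  have h1 : ((N + 1 : ℕ) : ℕ∞) ≤ N := (interior_subset hzB : z ∈ B).trans
    ((Set.encard_le_encard (germsAt_mono Metric.ball_subset_closedBall z)).trans
      (interior_subset hzA : z ∈ A))
  exact absurd (Nat.cast_le.1 h1) (by omega)

/-- A point with a finite orbit and infinitely many germs is an isolated fixed point of some
word. -/
theorem exists_isIsolatedFixedPoint (hV : IsAdmissible h V)
    (hfix : FixedPointsIsolatedOrTrivial h V) {V' : Set (Fin n → ℂ)} (hSV : S ⊆ V)
    (hSV' : S ⊆ V') {x : Fin n → ℂ} (horb : (orbit h V' x).Finite)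
    (hinf : (germsAt h S x).Infinite) : ∃ w, IsIsolatedFixedPoint (wordMap h w) x := by
  obtain ⟨T, hTS, hinj, hTc, -⟩ := exists_transversal h S x
  have hTinf : T.Infinite := by
    rw [← Set.encard_eq_top_iff, hTc]
    exact hinf.encard_eq
  have hmaps : Set.MapsTo (fun w => wordMap h w x) T (orbit h V' x) := fun w hw =>
    ⟨hSV' (hTS w hw).map_mem, w, (hTS w hw).mem_wordDom hSV', rfl⟩
  -- Pigeonhole: infinitely many germs, finitely many endpoints.
  obtain ⟨u, hu, v, hv, huv, heq⟩ := hTinf.exists_ne_map_eq_of_mapsTo hmaps horb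
  change wordMap h u x = wordMap h v x at heq
  have huV := (hTS u hu).mono hSV
  have hvV := (hTS v hv).mono hSV
  obtain ⟨h1, h2⟩ := hvV.invWord hV subset_rfl
  have hst : Stays h V (u ++ invWord v) x := Stays.append_iff.2 ⟨huV, heq ▸ h1⟩
  have hfixed : wordMap h (u ++ invWord v) x = x := by rw [wordMap_append, heq, h2]
  refine ⟨u ++ invWord v, (hfix _ x (hst.mem_wordDom subset_rfl) hfixed).resolve_right
    fun hid => huv (hinj hu hv (wordGerm_eq_iff.2 ?_))⟩
  -- If `u` followed by the inverse of `v` were the identity near `x`, then `u` and `v` would have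
  -- the same germ.
  have hc := (huV.analyticAt hV).continuousAt
  rw [ContinuousAt, heq] at hc
  filter_upwards [hid, hc.eventually (hvV.eventually_wordMap_invWord hV)] with y h3 h4
  rw [wordMap_append] at h3
  rw [← h4, h3]

/-! ### Countability of isolated fixed points against uncountably many radii -/

theorem countable_setOf_isIsolatedFixedPoint (g : (Fin n → ℂ) → (Fin n → ℂ)) :
    {x | IsIsolatedFixedPoint g x}.Countable := by
  have : DiscreteTopology {x | IsIsolatedFixedPoint g x} := by
    rw [discreteTopology_subtype_iff]
    intro x hx
    rw [inf_principal_eq_bot]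
    filter_upwards [hx.2] with y hy hy'
    exact hy hy'.1
  exact countable_of_Lindelof_of_discrete (X := {x | IsIsolatedFixedPoint g x})

theorem finite_germGroup_of_hasFiniteOrbits (hV : IsAdmissible h V)
    (hfix : FixedPointsIsolatedOrTrivial h V) (horb : HasFiniteOrbits h) :
    Finite (germGroup h) := by
  by_contra hinf
  obtain ⟨V', hV', horb⟩ := horb
  obtain ⟨R, hR, hRV⟩ := Metric.mem_nhds_iff.1
    ((hV.1.inter hV'.1).mem_nhds ⟨hV.2.1, hV'.2.1⟩)
  have hcount : (⋃ w, {x | IsIsolatedFixedPoint (wordMap h w) x}).Countable :=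
    Set.countable_iUnion fun w => countable_setOf_isIsolatedFixedPoint _
  -- Every radius in (0, R) is the norm of an isolated fixed point of some word.
  refine (Cardinal.Real.Ioo_countable_iff.not.2 (not_le.2 hR))
    ((hcount.image norm).mono fun r hr => ?_)
  have hsub : Metric.closedBall (0 : Fin n → ℂ) r ⊆ V ∩ V' :=
    (Metric.closedBall_subset_ball hr.2).trans hRV
  have hsubV := hsub.trans Set.inter_subset_left
  have hsubV' := hsub.trans Set.inter_subset_right
  obtain ⟨x, hx, hxinf⟩ := exists_infinite_germsAt hV hr.1 hsubV hinf
  obtain ⟨w, hw⟩ := exists_isIsolatedFixedPoint hV hfix hsubV hsubV'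
    (horb x (hsubV' (Metric.sphere_subset_closedBall hx))) hxinf
  exact ⟨x, Set.mem_iUnion.2 ⟨w, hw⟩, mem_sphere_zero_iff_norm.1 hx⟩

end LocalDynamics

end

theorem theoremA (n k : ℕ) (h : Fin k → LocalDynamics.LocalDiffeo n) (V : Set (Fin n → ℂ))
    (hV : LocalDynamics.IsAdmissible h V)
    (hfix : LocalDynamics.FixedPointsIsolatedOrTrivial h V) :
    LocalDynamics.HasFiniteOrbits h ↔ Finite (LocalDynamics.germGroup h) :=
  ⟨LocalDynamics.finite_germGroup_of_hasFiniteOrbits hV hfix,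
    LocalDynamics.hasFiniteOrbits_of_finite hV⟩
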